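/- For each $n\ge 1$ let $\lambda(n)>0$, and assume $\lambda(n)\to\infty$ and $\lambda(n)=o(n)$ as $n\to\infty$. Let the random set $\mathcal D\subseteq\{1,\dots,n\}$ of defectives be such that its cardinality $D$ has the right-truncated Poisson distribution $$P(D=d)=c(n)\,\frac{\lambda(n)^d}{d!}e^{-\lambda(n)},\quad 0\le d\le n,\qquad c(n)=\frac{e^{\lambda(n)}}{\sum_{d=0}^n\lambda(n)^d/d!},$$ and that, given $D=d$, all $d$-element subsets are equally likely. Let $\varepsilon>0$, $0<\gamma<1$, let $\alpha$ satisfy $1+\alpha\ge(1+\varepsilon)(1+\gamma)$, let $c>0$ be a constant, let $K>1$ be an integer, and put $\beta(n)=\log^{(K)}n=\log\log\cdots\log n$ ($K$-fold natural logarithm). Set $$m=m(n)=\left\lceil 2\lambda(n)^{1+\alpha}\left(\log n+c\,\beta(n)\log^3\lambda(n)\right)\right\rceil,$$ which is well defined and positive for all large $n$. Let $\mathbf C\in\{0,1\}^{m\times n}$ be a random test matrix, independent of $\mathcal D$, with i.i.d. Bernoulli$(p)$ entries, $p=\lceil\lambda(n)^{1+\varepsilon}\rceil^{-(1+\gamma)}$.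 The vector of test results $\mathbf y\in\{0,1\}^m$ is the Boolean OR of the columns of $\mathbf C$ indexed by $\mathcal D$; accordingly $P(\mathbf y\mid\mathbf C,\mathcal D')$ is $1$ if $\mathbf y$ is the OR of the columns of $\mathbf C$ indexed by $\mathcal D'$, and $0$ otherwise. Let $\mathcal E'$ be the event that there is a set $\mathcal D'\ne\mathcal D$ of subjects with $P(\mathbf y\mid\mathbf C,\mathcal D')\ge P(\mathbf y\mid\mathbf C,\mathcal D)$. Then $\lim_{n\to\infty}P(\mathcal E')=0$. Consequently, for any maximum likelihood decoder $\hat{\mathcal D}=\arg\max_{\mathcal D'}P(\mathbf y\mid\mathbf C,\mathcal D')$ (ties broken arbitrarily), $\lim_{n\to\infty}P(\hat{\mathcal D}\ne\mathcal D)=0$. In particular, for every $\alpha>0$ and every $c>0$, however small, $m$ tests suffice for a suitable choice of $\varepsilon>0$ and $0<\gamma<1$. -/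

import Mathlib

open MeasureTheory ProbabilityTheory Filter Topology

namespace PoissonGroupTesting

/-- A test matrix with `m` tests and `n` subjects: `C i j = true` when subject `j` takes part in
test `i`. -/
abbrev TestMatrix (m n : ℕ) : Type := Fin m → Fin n → Bool

/-- The vector of test results: test `i` is positive when it contains at least one defective
(the Boolean OR of the columns of `C` indexed by `S`). -/
def testResults {m n : ℕ} (C : TestMatrix m n) (S : Finset (Fin n)) : Fin m → Bool :=
  fun i => decide (∃ j ∈ S, C i j = true)

/-- The normalization `c(n) = exp lam / ∑_{d ≤ n} lam ^ d / d!` of the right-truncated Poisson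
distribution. -/
noncomputable def truncConst (n : ℕ) (lam : ℝ) : ℝ :=
  Real.exp lam / ∑ d ∈ Finset.range (n + 1), lam ^ d / (d.factorial : ℝ)

/-- The right-truncated Poisson probability mass function with parameters `lam` and `n`. -/
noncomputable def truncPoisson (n : ℕ) (lam : ℝ) (d : ℕ) : ℝ :=
  if d ≤ n then truncConst n lam * (lam ^ d / (d.factorial : ℝ)) * Real.exp (-lam) else 0

/-- The law of the set of defectives: its cardinality is right-truncated Poisson, and all sets of
the same cardinality are equally likely. -/
noncomputable def defectivesLaw (n : ℕ) (lam : ℝ) : Measure (Finset (Fin n)) :=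
  ∑ S : Finset (Fin n),
    ENNReal.ofReal (truncPoisson n lam S.card / (n.choose S.card : ℝ)) • Measure.dirac S

/-- The law of a test matrix with i.i.d. Bernoulli(`p`) entries. -/
noncomputable def testMatrixLaw (m n : ℕ) (p : unitInterval) : Measure (TestMatrix m n) :=
  Measure.pi fun _ : Fin m => Measure.pi fun _ : Fin n => bernoulliMeasure true false p

/-- The joint law of the test matrix and of the set of defectives, which are independent. -/
noncomputable def modelLaw (m n : ℕ) (p : unitInterval) (lam : ℝ) :
    Measure (TestMatrix m n × Finset (Fin n)) :=
  (testMatrixLaw m n p).prod (defectivesLaw n lam)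

/-- The likelihood `P(y | C, S)`. The tests are error-free, so given `C` and `S` the vector of
results is `testResults C S` with probability one. -/
def likelihood {m n : ℕ} (C : TestMatrix m n) (S : Finset (Fin n)) (y : Fin m → Bool) : ℝ :=
  if y = testResults C S then 1 else 0

/-- A maximum likelihood decoder: its output maximizes `P(y | C, S)` over all sets `S` of
subjects; ties are broken arbitrarily. -/
def IsMLDecoder {m n : ℕ} (f : TestMatrix m n → (Fin m → Bool) → Finset (Fin n)) : Prop :=
  ∀ C y S, likelihood C S y ≤ likelihood C (f C y) y

/-- The event that the decoder `f` does not return the set of defectives. -/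
def errorEvent {m n : ℕ} (f : TestMatrix m n → (Fin m → Bool) → Finset (Fin n)) :
    Set (TestMatrix m n × Finset (Fin n)) :=
  {ω | f ω.1 (testResults ω.1 ω.2) ≠ ω.2}

/-- The event that some other set of subjects is at least as likely as the true one, given the
test matrix and the test results. It contains `errorEvent f` for every ML decoder `f`. -/
def mlErrorEvent (m n : ℕ) : Set (TestMatrix m n × Finset (Fin n)) :=
  {ω | ∃ S : Finset (Fin n), S ≠ ω.2 ∧
    likelihood ω.1 ω.2 (testResults ω.1 ω.2) ≤ likelihood ω.1 S (testResults ω.1 ω.2)}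

/-- The entry probability `p = ⌈lam ^ (1 + ε)⌉ ^ (-(1 + γ))`. -/
noncomputable def entryProb (lam ε γ : ℝ) (hγ : 0 < γ) : unitInterval :=
  ⟨(⌈lam ^ (1 + ε)⌉₊ : ℝ) ^ (-(1 + γ)), by
    refine ⟨by positivity, ?_⟩
    rcases Nat.eq_zero_or_pos ⌈lam ^ (1 + ε)⌉₊ with h | h
    · rw [h, Nat.cast_zero, Real.zero_rpow (by linarith)]
      exact zero_le_one
    · exact Real.rpow_le_one_of_one_le_of_nonpos (by exact_mod_cast h) (by linarith)⟩

/-- The `K`-fold (natural) logarithm. -/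
noncomputable def iterLog (K : ℕ) (x : ℝ) : ℝ := Real.log^[K] x

/-- The number of tests `2 lam ^ (1 + α) (log n + c log^(K) n (log lam) ^ 3)`, rounded up. -/
noncomputable def numTests (n : ℕ) (lam α c : ℝ) (K : ℕ) : ℕ :=
  ⌈2 * lam ^ (1 + α) * (Real.log n + c * iterLog K n * Real.log lam ^ 3)⌉₊

end PoissonGroupTesting

namespace PoissonGroupTesting

/-! Call a test isolating for `j` when it contains `j` and no other member of the true set `S`. If
every subject, defective or not, has an isolating test, then `S` is the only set explaining the
results (`eq_of_testResults_eq`). A test isolates a given subject with probability at least `p (1 -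
p |S|)`, so a union bound over the `n` subjects gives error at most `n exp (-3/4 m p)` when `p |S| ≤
1/4`. Larger sets are handled by a Markov-type bound: since the mean of `|S|` is at most `lam`, they
cost at most `4 p lam ≤ 4 lam ^ (-ε)`. Finally `m p ≥ 5/3 log n` makes the first term at most `n ^
(-1/4)`. -/

/-- The rows of a test matrix in which `j` takes part and no other member of `S` does. -/
def isolatingRows {n : ℕ} (S : Finset (Fin n)) (j : Fin n) : Set (Fin n → Bool) :=
  {r | r j = true ∧ ∀ k ∈ S, k ≠ j → r k = false}

/-- If every subject is isolated from the other members of `S` by some test, then `S` is the only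
set that explains the results of `S`. -/
theorem eq_of_testResults_eq {m n : ℕ} {C : TestMatrix m n} {S T : Finset (Fin n)}
    (hC : ∀ j, ∃ i, C i ∈ isolatingRows S j) (h : testResults C S = testResults C T) : T = S := by
  have key : ∀ i, (∃ j ∈ S, C i j = true) ↔ ∃ j ∈ T, C i j = true := fun i => by
    simpa [testResults] using congrFun h i
  -- A test isolating `j ∈ T \ S` would be positive for `T` and negative for `S`.
  have hTS : T ⊆ S := by
    intro j hj
    obtain ⟨i, hij, hi⟩ := hC j
    obtain ⟨k, hk, hik⟩ := (key i).2 ⟨j, hj, hij⟩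
    by_cases hkj : k = j
    · exact hkj ▸ hk
    · simp [hi k hk hkj] at hik
  -- A test isolating `j ∈ S` is positive, and within `T ⊆ S` only `j` can make it so.
  refine Finset.Subset.antisymm hTS ?_
  intro j hj
  obtain ⟨i, hij, hi⟩ := hC j
  obtain ⟨k, hk, hik⟩ := (key i).1 ⟨j, hj, hij⟩
  by_cases hkj : k = j
  · exact hkj ▸ hk
  · simp [hi k (hTS hk) hkj] at hik

/-- The true set has likelihood 1, so a competitor that is at least as likely must produce the same
results. -/
theorem mlErrorEvent_section_subset {m n : ℕ} (S : Finset (Fin n)) :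
    (fun C : TestMatrix m n => (C, S)) ⁻¹' mlErrorEvent m n ⊆
      ⋃ j, Set.univ.pi fun _ : Fin m => (isolatingRows S j)ᶜ := by
  rintro C ⟨T, hT, hle⟩
  by_contra hC
  simp only [Set.mem_iUnion, Set.mem_univ_pi, Set.mem_compl_iff, not_exists, not_forall,
    not_not] at hC
  refine hT (eq_of_testResults_eq hC ?_)
  by_contra hne
  simp only [likelihood, if_true, if_neg hne] at hle
  linarith

theorem errorEvent_subset_mlErrorEvent {m n : ℕ}
    {f : TestMatrix m n → (Fin m → Bool) → Finset (Fin n)} (hf : IsMLDecoder f) :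
    errorEvent f ⊆ mlErrorEvent m n :=
  fun ω hω => ⟨f ω.1 (testResults ω.1 ω.2), hω, hf _ _ _⟩

/-- By independence of the entries the probability is `p (1 - p) ^ |S \ {j}|`. Bernoulli's
inequality gives a bound that ignores whether `j ∈ S`. -/
theorem le_measureReal_isolatingRows {n : ℕ} (p : unitInterval) (S : Finset (Fin n)) (j : Fin n) :
    (p : ℝ) * (1 - p * S.card) ≤
      (Measure.pi fun _ : Fin n => bernoulliMeasure true false p).real (isolatingRows S j) := by
  have hp0 : 0 ≤ (p : ℝ) := p.2.1
  have hp1 : (p : ℝ) ≤ 1 := p.2.2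
  have hset : isolatingRows S j = Set.univ.pi fun k : Fin n =>
      if k = j then {true} else if k ∈ S then {false} else Set.univ := by
    ext r
    simp only [isolatingRows, Set.mem_ofPred_eq, Set.mem_univ_pi]
    constructor
    · rintro ⟨h1, h2⟩ k
      by_cases hk : k = j
      · simp [hk, h1]
      · by_cases hkS : k ∈ S <;> simp [hk, hkS, h2]
    · intro h
      refine ⟨by simpa using h j, fun k hk hkj => by simpa [hk, hkj] using h k⟩
  have hfac : ∀ k : Fin n, (bernoulliMeasure true false p).real
      (if k = j then {true} else if k ∈ S then {false} else Set.univ) =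
      (if k = j then (p : ℝ) else 1) * if k ∈ S.erase j then 1 - (p : ℝ) else 1 := by
    intro k
    by_cases hk : k = j
    · simp [hk]
    · by_cases hkS : k ∈ S <;> simp [hk, hkS]
  have hreal : (Measure.pi fun _ : Fin n => bernoulliMeasure true false p).real
      (isolatingRows S j) = p * (1 - (p : ℝ)) ^ (S.erase j).card := by
    rw [hset, measureReal_def, Measure.pi_pi, ENNReal.toReal_prod]
    simp only [← measureReal_def, hfac, Finset.prod_mul_distrib, Finset.prod_ite_eq',
      Finset.mem_univ, if_true, Finset.prod_ite_mem, Finset.univ_inter, Finset.prod_const]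
  rw [hreal]
  refine mul_le_mul_of_nonneg_left ?_ hp0
  calc 1 - (p : ℝ) * S.card = 1 + S.card * (-p : ℝ) := by ring
    _ ≤ (1 + (-p : ℝ)) ^ S.card := one_add_mul_le_pow (by linarith) _
    _ = (1 - (p : ℝ)) ^ S.card := by rw [← sub_eq_add_neg]
    _ ≤ (1 - (p : ℝ)) ^ (S.erase j).card :=
      pow_le_pow_of_le_one (by linarith) (by linarith) (Finset.card_le_card (S.erase_subset j))

theorem testMatrixLaw_real_pi_compl_isolatingRows_le {m n : ℕ} (p : unitInterval)
    (S : Finset (Fin n)) (j : Fin n) :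
    (testMatrixLaw m n p).real (Set.univ.pi fun _ : Fin m => (isolatingRows S j)ᶜ) ≤
      Real.exp (-(m * p * (1 - p * S.card))) := by
  rw [testMatrixLaw, measureReal_def, Measure.pi_pi, ENNReal.toReal_prod]
  simp only [← measureReal_def, Finset.prod_const, Finset.card_univ, Fintype.card_fin]
  rw [probReal_compl_eq_one_sub (Set.toFinite _).measurableSet]
  have h := le_measureReal_isolatingRows p S j
  calc _ ≤ Real.exp (-(p * (1 - p * S.card) : ℝ)) ^ m := by
        refine pow_le_pow_left₀ (sub_nonneg.2 measureReal_le_one) ?_ m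
        linarith [Real.add_one_le_exp (-(p * (1 - p * S.card) : ℝ))]
    _ = _ := by rw [← Real.exp_nat_mul]; congr 1; ring

instance {m n : ℕ} (p : unitInterval) : IsProbabilityMeasure (testMatrixLaw m n p) := by
  unfold testMatrixLaw; infer_instance

/-- For a fixed set of defectives, the probability that it is not identified. The second term
accounts for the sets that are too large. -/
theorem testMatrixLaw_real_mlErrorEvent_section_le {m n : ℕ} (p : unitInterval)
    (S : Finset (Fin n)) :
    (testMatrixLaw m n p).real ((fun C => (C, S)) ⁻¹' mlErrorEvent m n) ≤
      n * Real.exp (-(3 / 4 * (m * p))) + 4 * p * S.card := by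
  have hp0 : 0 ≤ (p : ℝ) := p.2.1
  have hexp : 0 ≤ n * Real.exp (-(3 / 4 * (m * p) : ℝ)) := by positivity
  have hcard : 0 ≤ 4 * (p : ℝ) * S.card := by positivity
  rcases le_or_gt ((p : ℝ) * S.card) (1 / 4) with h | h
  · calc _ ≤ (testMatrixLaw m n p).real
          (⋃ j, Set.univ.pi fun _ : Fin m => (isolatingRows S j)ᶜ) :=
          measureReal_mono (mlErrorEvent_section_subset S)
      _ ≤ ∑ j, (testMatrixLaw m n p).real
          (Set.univ.pi fun _ : Fin m => (isolatingRows S j)ᶜ) := measureReal_iUnion_fintype_le _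
      _ ≤ ∑ _j : Fin n, Real.exp (-(3 / 4 * (m * p) : ℝ)) := by
          refine Finset.sum_le_sum fun j _ =>
            (testMatrixLaw_real_pi_compl_isolatingRows_le p S j).trans ?_
          have hmp : 0 ≤ (m * p : ℝ) := by positivity
          rw [Real.exp_le_exp]
          nlinarith
      _ = n * Real.exp (-(3 / 4 * (m * p) : ℝ)) := by simp
      _ ≤ _ := le_add_of_nonneg_right hcard
  -- Here `4 p |S| > 1`, so the bound is trivial.
  · have h1 : (testMatrixLaw m n p).real ((fun C => (C, S)) ⁻¹' mlErrorEvent m n) ≤ 1 :=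
      measureReal_le_one
    linarith

theorem truncPoisson_eq {n : ℕ} (lam : ℝ) {d : ℕ} (hd : d ≤ n) :
    truncPoisson n lam d =
      lam ^ d / (d.factorial : ℝ) / ∑ d ∈ Finset.range (n + 1), lam ^ d / (d.factorial : ℝ) := by
  have h : Real.exp lam * Real.exp (-lam) = 1 := by rw [← Real.exp_add]; simp
  rw [truncPoisson, if_pos hd, truncConst]
  linear_combination (lam ^ d / (d.factorial : ℝ) /
    ∑ d ∈ Finset.range (n + 1), lam ^ d / (d.factorial : ℝ)) * h

theorem truncPoisson_nonneg {lam : ℝ} (hlam : 0 ≤ lam) (n d : ℕ) : 0 ≤ truncPoisson n lam d := by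
  unfold truncPoisson truncConst
  split_ifs <;> positivity

theorem truncPoisson_normalizer_pos {lam : ℝ} (hlam : 0 ≤ lam) (n : ℕ) :
    0 < ∑ d ∈ Finset.range (n + 1), lam ^ d / (d.factorial : ℝ) := by
  refine Finset.sum_pos' (fun _ _ => by positivity) ⟨0, by simp, by simp⟩

theorem sum_truncPoisson {lam : ℝ} (hlam : 0 ≤ lam) (n : ℕ) :
    ∑ d ∈ Finset.range (n + 1), truncPoisson n lam d = 1 := by
  rw [Finset.sum_congr rfl fun d hd =>
    truncPoisson_eq lam (Nat.lt_succ_iff.1 (Finset.mem_range.1 hd)), ← Finset.sum_div,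
    div_self (truncPoisson_normalizer_pos hlam n).ne']

/-- Truncation does not increase the mean of a Poisson variable. -/
theorem sum_truncPoisson_mul_le {lam : ℝ} (hlam : 0 ≤ lam) (n : ℕ) :
    ∑ d ∈ Finset.range (n + 1), truncPoisson n lam d * d ≤ lam := by
  have hZ := truncPoisson_normalizer_pos hlam n
  have h : ∑ d ∈ Finset.range (n + 1), truncPoisson n lam d * d =
      (∑ d ∈ Finset.range (n + 1), lam ^ d / (d.factorial : ℝ) * d) /
        ∑ d ∈ Finset.range (n + 1), lam ^ d / (d.factorial : ℝ) := by
    rw [Finset.sum_div]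
    refine Finset.sum_congr rfl fun d hd => ?_
    rw [truncPoisson_eq lam (Nat.lt_succ_iff.1 (Finset.mem_range.1 hd))]
    ring
  -- The term `d = 0` vanishes and `d lam ^ d / d! = lam * lam ^ (d - 1) / (d - 1)!`: the numerator
  -- is `lam` times the normalizer without its top term.
  rw [h, div_le_iff₀ hZ, Finset.sum_range_succ']
  simp only [Nat.cast_zero, mul_zero, add_zero]
  rw [Finset.sum_range_succ, mul_add, Finset.mul_sum]
  refine le_add_of_le_of_nonneg (le_of_eq (Finset.sum_congr rfl fun d _ => ?_)) (by positivity)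
  rw [Nat.factorial_succ]
  push_cast
  have : (d.factorial : ℝ) ≠ 0 := by positivity
  have : (d + 1 : ℝ) ≠ 0 := by positivity
  field_simp
  ring

theorem sum_truncPoisson_div_choose_mul (n : ℕ) (lam : ℝ) (g : ℕ → ℝ) :
    ∑ S : Finset (Fin n), truncPoisson n lam S.card / (n.choose S.card : ℝ) * g S.card =
      ∑ d ∈ Finset.range (n + 1), truncPoisson n lam d * g d := by
  rw [← Finset.powerset_univ,
    Finset.sum_powerset_apply_card (fun d => truncPoisson n lam d / (n.choose d : ℝ) * g d)]
  simp only [Finset.card_univ, Fintype.card_fin, nsmul_eq_mul]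
  refine Finset.sum_congr rfl fun d hd => ?_
  have : (n.choose d : ℝ) ≠ 0 := by
    exact_mod_cast (Nat.choose_pos (Nat.lt_succ_iff.1 (Finset.mem_range.1 hd))).ne'
  field_simp

/-- Integrate the bound for fixed `S`: it is affine in `|S|`, so only the mean of `|S|` enters. -/
theorem modelLaw_mlErrorEvent_le {lam : ℝ} (hlam : 0 ≤ lam) (m n : ℕ) (p : unitInterval) :
    modelLaw m n p lam (mlErrorEvent m n) ≤
      ENNReal.ofReal (n * Real.exp (-(3 / 4 * (m * p))) + 4 * p * lam) := by
  have hp0 : 0 ≤ (p : ℝ) := p.2.1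
  have hw : ∀ S : Finset (Fin n), 0 ≤ truncPoisson n lam S.card / (n.choose S.card : ℝ) :=
    fun S => div_nonneg (truncPoisson_nonneg hlam _ _) (Nat.cast_nonneg _)
  have : SFinite (defectivesLaw n lam) := by unfold defectivesLaw; infer_instance
  rw [modelLaw, Measure.prod_apply_symm (Set.toFinite _).measurableSet, defectivesLaw,
    lintegral_finsetSum_measure]
  simp only [lintegral_smul_measure, lintegral_dirac, smul_eq_mul]
  calc _ ≤ ∑ S : Finset (Fin n), ENNReal.ofReal (truncPoisson n lam S.card / (n.choose S.card : ℝ) *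
          (n * Real.exp (-(3 / 4 * (m * p))) + 4 * p * S.card)) := by
        refine Finset.sum_le_sum fun S _ => ?_
        rw [ENNReal.ofReal_mul (hw S)]
        gcongr
        rw [← ofReal_measureReal]
        exact ENNReal.ofReal_le_ofReal (testMatrixLaw_real_mlErrorEvent_section_le p S)
    _ ≤ _ := by
        rw [← ENNReal.ofReal_sum_of_nonneg fun S _ => mul_nonneg (hw S) (by positivity),
          sum_truncPoisson_div_choose_mul n lam
            fun d => n * Real.exp (-(3 / 4 * (m * p) : ℝ)) + 4 * p * d]
        refine ENNReal.ofReal_le_ofReal ?_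
        calc _ = n * Real.exp (-(3 / 4 * (m * p) : ℝ)) *
                (∑ d ∈ Finset.range (n + 1), truncPoisson n lam d) +
              4 * p * ∑ d ∈ Finset.range (n + 1), truncPoisson n lam d * d := by
              rw [Finset.mul_sum, Finset.mul_sum, ← Finset.sum_add_distrib]
              exact Finset.sum_congr rfl fun d _ => by ring
          _ ≤ _ := by
              rw [sum_truncPoisson hlam, mul_one]
              gcongr
              exact sum_truncPoisson_mul_le hlam n

theorem tendsto_iterLog_atTop (K : ℕ) : Tendsto (iterLog K) atTop atTop :=
  Real.tendsto_log_atTop.iterate K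

/-- The mean number of defectives in a test tends to zero. -/
theorem entryProb_mul_le {lam : ℝ} (hlam : 1 ≤ lam) {ε γ : ℝ} (hε : 0 < ε) (hγ : 0 < γ) :
    (entryProb lam ε γ hγ : ℝ) * lam ≤ lam ^ (-ε) := by
  have h0 : 0 < lam := by linarith
  have hq : lam ^ (1 + ε) ≤ (⌈lam ^ (1 + ε)⌉₊ : ℝ) := Nat.le_ceil _
  have hx : 1 ≤ lam ^ (1 + ε) := Real.one_le_rpow hlam (by linarith)
  calc (entryProb lam ε γ hγ : ℝ) * lam
      = (⌈lam ^ (1 + ε)⌉₊ : ℝ) ^ (-(1 + γ)) * lam := rfl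
    _ ≤ (⌈lam ^ (1 + ε)⌉₊ : ℝ) ^ (-1 : ℝ) * lam := by
        refine mul_le_mul_of_nonneg_right ?_ h0.le
        exact Real.rpow_le_rpow_of_exponent_le (hx.trans hq) (by linarith)
    _ ≤ (lam ^ (1 + ε)) ^ (-1 : ℝ) * lam := by
        refine mul_le_mul_of_nonneg_right ?_ h0.le
        exact Real.rpow_le_rpow_of_nonpos (by positivity) hq (by norm_num)
    _ = lam ^ (-ε) := by
        rw [← Real.rpow_mul h0.le]
        nth_rewrite 2 [← Real.rpow_one lam]
        rw [← Real.rpow_add h0]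
        congr 1; ring

/-- For large parameters a subject takes part in at least `5 / 3 * log n` tests on average. -/
theorem le_numTests_mul_entryProb {lam ε γ α c : ℝ} {K n : ℕ} (hlam : 1 ≤ lam)
    (hx : 16 ≤ lam ^ (1 + ε)) (hγ : 0 < γ) (hγ1 : γ < 1)
    (hα : (1 + ε) * (1 + γ) ≤ 1 + α) (hc : 0 < c) (hn : 1 ≤ n) (hβ : 0 ≤ iterLog K n) :
    5 / 3 * Real.log n ≤ numTests n lam α c K * (entryProb lam ε γ hγ : ℝ) := by
  have h0 : 0 < lam := by linarith
  have hlog : 0 ≤ Real.log n := Real.log_nonneg (by exact_mod_cast hn)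
  have hloglam : 0 ≤ Real.log lam := Real.log_nonneg hlam
  have hm : 2 * lam ^ (1 + α) * Real.log n ≤ numTests n lam α c K := by
    refine le_trans ?_ (Nat.le_ceil _)
    gcongr
    -- The iterated-logarithm term is only needed to be nonnegative.
    exact le_add_of_nonneg_right (by positivity)
  -- Rounding up adds at most 1, which is at most a sixteenth of `lam ^ (1 + ε)`.
  have hq : (⌈lam ^ (1 + ε)⌉₊ : ℝ) ≤ lam ^ (1 + ε) * (17 / 16) := by
    have := (Nat.ceil_lt_add_one (a := lam ^ (1 + ε)) (by positivity)).le
    linarith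
  have hq0 : (0 : ℝ) < ⌈lam ^ (1 + ε)⌉₊ := lt_of_lt_of_le (by linarith) (Nat.le_ceil _)
  have hp : (lam ^ (1 + α))⁻¹ * (5 / 6) ≤ (entryProb lam ε γ hγ : ℝ) := by
    calc (lam ^ (1 + α))⁻¹ * (5 / 6)
        ≤ (lam ^ ((1 + ε) * (1 + γ)))⁻¹ * (17 / 16 : ℝ) ^ (-(1 + γ)) := by
          gcongr
          -- The exponent `1 + γ` is below 2, and `(16 / 17) ^ 2 > 5 / 6`.
          calc (5 / 6 : ℝ) ≤ (17 / 16 : ℝ) ^ (-2 : ℝ) := by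
                rw [Real.rpow_neg (by norm_num)]; norm_num
            _ ≤ _ := Real.rpow_le_rpow_of_exponent_le (by norm_num) (by linarith)
      _ = (lam ^ (1 + ε) * (17 / 16)) ^ (-(1 + γ)) := by
          rw [Real.mul_rpow (by positivity) (by norm_num), ← Real.rpow_mul h0.le, mul_neg,
            Real.rpow_neg h0.le]
      _ ≤ (⌈lam ^ (1 + ε)⌉₊ : ℝ) ^ (-(1 + γ)) :=
          Real.rpow_le_rpow_of_nonpos hq0 hq (by linarith)
      _ = _ := rfl
  have hpow : 0 < lam ^ (1 + α) := by positivity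
  calc 5 / 3 * Real.log n
      = 2 * lam ^ (1 + α) * Real.log n * ((lam ^ (1 + α))⁻¹ * (5 / 6)) := by field_simp; ring
    _ ≤ _ := by gcongr

theorem tendsto_modelLaw_mlErrorEvent {lam : ℕ → ℝ} (hlam_top : Tendsto lam atTop atTop)
    {ε γ α c : ℝ} (hε : 0 < ε) (hγ : 0 < γ) (hγ1 : γ < 1)
    (hα : (1 + ε) * (1 + γ) ≤ 1 + α) (hc : 0 < c) (K : ℕ) :
    Tendsto
      (fun n : ℕ => modelLaw (numTests n (lam n) α c K) n (entryProb (lam n) ε γ hγ) (lam n)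
        (mlErrorEvent (numTests n (lam n) α c K) n))
      atTop (𝓝 0) := by
  have hbound : Tendsto
      (fun n : ℕ => ENNReal.ofReal ((n : ℝ) ^ (-(1 / 4) : ℝ) + 4 * lam n ^ (-ε))) atTop (𝓝 0) := by
    have h1 : Tendsto (fun n : ℕ => (n : ℝ) ^ (-(1 / 4) : ℝ)) atTop (𝓝 0) :=
      (tendsto_rpow_neg_atTop (by norm_num)).comp tendsto_natCast_atTop_atTop
    have h2 : Tendsto (fun n : ℕ => lam n ^ (-ε)) atTop (𝓝 0) :=
      (tendsto_rpow_neg_atTop hε).comp hlam_top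
    simpa using ENNReal.tendsto_ofReal (h1.add (h2.const_mul 4))
  refine tendsto_of_tendsto_of_tendsto_of_le_of_le' tendsto_const_nhds hbound
    (Eventually.of_forall fun _ => zero_le) ?_
  filter_upwards [hlam_top.eventually_ge_atTop 1,
    ((tendsto_rpow_atTop (by linarith : 0 < 1 + ε)).comp hlam_top).eventually_ge_atTop 16,
    ((tendsto_iterLog_atTop K).comp tendsto_natCast_atTop_atTop).eventually_ge_atTop 0,
    eventually_ge_atTop 1] with n hlam hx hβ hn
  refine (modelLaw_mlErrorEvent_le (by linarith) _ n _).trans (ENNReal.ofReal_le_ofReal ?_)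
  have hn0 : (0 : ℝ) < n := by exact_mod_cast hn
  have hmp := le_numTests_mul_entryProb (K := K) hlam hx hγ hγ1 hα hc hn hβ
  refine add_le_add ?_ (by rw [mul_assoc]; gcongr; exact entryProb_mul_le hlam hε hγ)
  -- Since `3/4 * 5/3 = 5/4 > 1`, the exponential beats the factor `n` of the union bound.
  calc n * Real.exp (-(3 / 4 * (numTests n (lam n) α c K * (entryProb (lam n) ε γ hγ : ℝ))))
      ≤ Real.exp (Real.log n) * Real.exp (-(5 / 4 * Real.log n)) := by
        rw [Real.exp_log hn0]
        refine mul_le_mul_of_nonneg_left (Real.exp_le_exp.2 ?_) hn0.le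
        linarith
    _ = (n : ℝ) ^ (-(1 / 4) : ℝ) := by
        rw [← Real.exp_add, Real.rpow_def_of_pos hn0]
        congr 1; ring

end PoissonGroupTesting

theorem theorem10
    (lam : ℕ → ℝ)
    (hlam_little : lam =o[atTop] (fun n : ℕ => (n : ℝ)))
    (hlam_top : Tendsto lam atTop atTop)
    (ε γ α c : ℝ) (hε : 0 < ε) (hγ : 0 < γ) (hγ1 : γ < 1)
    (hα : (1 + ε) * (1 + γ) ≤ 1 + α) (hc : 0 < c)
    (K : ℕ) (hK : 1 < K) :
    Tendsto
      (fun n : ℕ =>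
        PoissonGroupTesting.modelLaw (PoissonGroupTesting.numTests n (lam n) α c K) n
          (PoissonGroupTesting.entryProb (lam n) ε γ hγ) (lam n)
          (PoissonGroupTesting.mlErrorEvent (PoissonGroupTesting.numTests n (lam n) α c K) n))
      atTop (𝓝 0) ∧
    ∀ f : (n : ℕ) →
        PoissonGroupTesting.TestMatrix (PoissonGroupTesting.numTests n (lam n) α c K) n →
        (Fin (PoissonGroupTesting.numTests n (lam n) α c K) → Bool) → Finset (Fin n),
      (∀ n, PoissonGroupTesting.IsMLDecoder (f n)) →
      Tendsto
        (fun n : ℕ =>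
          PoissonGroupTesting.modelLaw (PoissonGroupTesting.numTests n (lam n) α c K) n
            (PoissonGroupTesting.entryProb (lam n) ε γ hγ) (lam n)
            (PoissonGroupTesting.errorEvent (f n)))
        atTop (𝓝 0) := by
  have h := PoissonGroupTesting.tendsto_modelLaw_mlErrorEvent hlam_top hε hγ hγ1 hα hc K
  refine ⟨h, fun f hf => tendsto_of_tendsto_of_tendsto_of_le_of_le tendsto_const_nhds h
    (fun _ => zero_le) fun n => measure_mono ?_⟩
  exact PoissonGroupTesting.errorEvent_subset_mlErrorEvent (hf n)
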